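/- Let $n\in\{2,3\}$, let $\alpha,\gamma,d>0$ be constants, let $\|\cdot\|$ be the Euclidean norm, and let inequalities between symmetric matrices be in the Loewner order. Let $A:\mathbb{R}\to\mathbb{R}^{n\times n}$ satisfy: (i) there is $T>0$ with $A(t+T)=A(t)$ for all $t$; (ii) $A(t)$ is skew-symmetric for all $t$; (iii) $A$ is differentiable everywhere; (iv) for every solution $y^*$ on $[0,\infty)$ of $\dot y^*(t)=A(t)y^*(t)$ with $y^*(0)\neq 0$ there are $T_1,\alpha_1,\alpha_2>0$ such that for all $t\ge 0$ $$\alpha_1\|y^*(t)\|^2 I\le\int_t^{t+T_1}\dot y^*(\tau)\dot y^*(\tau)^\top d\tau\le\alpha_2\|y^*(t)\|^2 I .$$ Let $x\in\mathbb{R}^n$ be a fixed source position, and let $z_1,z_2:[0,\infty)\to\mathbb{R}$ and $z_3,\hat x,y:[0,\infty)\to\mathbb{R}^n$ be a solution on $[0,\infty)$ (with arbitrary initial values, subject only to the condition below) of the closed-loop system $$\dot z_1=\eta:=-\alpha z_1+\tfrac12\|y-x\|^2,\qquad \dot z_2=m:=-\alpha z_2+\tfrac12 y^\top y,\qquad \dot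 z_3=V:=-\alpha z_3+y,$$ $$\dot{\hat x}=-\gamma V\,(\eta-m+V^\top\hat x),$$ $$\dot y=\dot{\hat x}-\big[(\hat D^2-d^2)I-A(t)\big](y-\hat x),\qquad \hat D:=\|y-\hat x\|.$$ Suppose that $\hat D(0)>0$. Then the filtered position signal $V$ is persistently exciting: there exist $\alpha_3>0$, $\alpha_4>0$ and $T_3>0$ such that for all $t\ge 0$ $$\alpha_3 I\le\int_t^{t+T_3}V(\tau)V(\tau)^\top d\tau\le\alpha_4 I .$$ -/

import Mathlib

open Set
open scoped Matrix MatrixOrder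

noncomputable section

namespace Circumnavigation

/-- The matrix `∫_a^b v(τ) v(τ)ᵀ dτ`, the integral being taken entry by entry. -/
def gramian {n : ℕ} (v : ℝ → EuclideanSpace ℝ (Fin n)) (a b : ℝ) :
    Matrix (Fin n) (Fin n) ℝ :=
  Matrix.of fun i j => ∫ τ in a..b, Matrix.vecMulVec (v τ) (v τ) i j

/-- `ystar` solves the linear system `ẏ*(t) = A(t) y*(t)` on `[0, ∞)`. -/
def IsLinearSolution {n : ℕ} (A : ℝ → Matrix (Fin n) (Fin n) ℝ)
    (ystar : ℝ → EuclideanSpace ℝ (Fin n)) : Prop :=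
  ∀ t : ℝ, 0 ≤ t →
    HasDerivWithinAt ystar (WithLp.toLp 2 (A t *ᵥ ystar t)) (Ici 0) t

/-- The derivative of `ystar` is persistently spanning. The order on matrices is the Loewner
order: `M ≤ N` means that `N - M` is positive semidefinite. -/
def DerivPersistentlySpanning {n : ℕ} (ystar : ℝ → EuclideanSpace ℝ (Fin n)) : Prop :=
  ∃ T₁ α₁ α₂ : ℝ, 0 < T₁ ∧ 0 < α₁ ∧ 0 < α₂ ∧ ∀ t : ℝ, 0 ≤ t →
    (α₁ * ‖ystar t‖ ^ 2) • (1 : Matrix (Fin n) (Fin n) ℝ)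
        ≤ gramian (derivWithin ystar (Ici 0)) t (t + T₁) ∧
      gramian (derivWithin ystar (Ici 0)) t (t + T₁)
        ≤ (α₂ * ‖ystar t‖ ^ 2) • (1 : Matrix (Fin n) (Fin n) ℝ)

/-- The four conditions on the matrix function `A` in the control law. -/
structure AdmissibleMatrix {n : ℕ} (A : ℝ → Matrix (Fin n) (Fin n) ℝ) : Prop where
  periodic : ∃ T : ℝ, 0 < T ∧ ∀ t : ℝ, A (t + T) = A t
  skew : ∀ t : ℝ, (A t)ᵀ = -A t
  differentiable : ∀ i j : Fin n, Differentiable ℝ fun t => A t i j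
  spanning : ∀ ystar : ℝ → EuclideanSpace ℝ (Fin n),
    IsLinearSolution A ystar → ystar 0 ≠ 0 → DerivPersistentlySpanning ystar

/-- The signal `η = -α z₁ + D² / 2`, where `D = ‖y - x‖` is the measured distance. -/
def eta {n : ℕ} (α : ℝ) (x : EuclideanSpace ℝ (Fin n)) (z₁ : ℝ → ℝ)
    (y : ℝ → EuclideanSpace ℝ (Fin n)) (t : ℝ) : ℝ :=
  -α * z₁ t + (1 / 2) * ‖y t - x‖ ^ 2

/-- The signal `m = -α z₂ + yᵀ y / 2`. -/
def mSignal {n : ℕ} (α : ℝ) (z₂ : ℝ → ℝ)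
    (y : ℝ → EuclideanSpace ℝ (Fin n)) (t : ℝ) : ℝ :=
  -α * z₂ t + (1 / 2) * inner ℝ (y t) (y t)

/-- The filtered position signal `V = -α z₃ + y`. -/
def filteredPosition {n : ℕ} (α : ℝ) (z₃ y : ℝ → EuclideanSpace ℝ (Fin n)) (t : ℝ) :
    EuclideanSpace ℝ (Fin n) :=
  -α • z₃ t + y t

/-- The right-hand side `-γ V (η - m + Vᵀ x̂)` of the estimator. -/
def estimatorRate {n : ℕ} (α γ : ℝ) (x : EuclideanSpace ℝ (Fin n)) (z₁ z₂ : ℝ → ℝ)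
    (z₃ xhat y : ℝ → EuclideanSpace ℝ (Fin n)) (t : ℝ) : EuclideanSpace ℝ (Fin n) :=
  -(γ * (eta α x z₁ y t - mSignal α z₂ y t
      + inner ℝ (filteredPosition α z₃ y t) (xhat t))) • filteredPosition α z₃ y t

/-- `(z₁, z₂, z₃, x̂, y)` is a trajectory on `[0, ∞)` of the closed-loop system with source
position `x`, filter constant `α`, adaptive gain `γ`, desired distance `d`, and control
matrix `A`. At `t = 0` the derivatives are one-sided; the initial state is arbitrary. -/
structure IsTrajectory {n : ℕ} (α γ d : ℝ) (A : ℝ → Matrix (Fin n) (Fin n) ℝ)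
    (x : EuclideanSpace ℝ (Fin n)) (z₁ z₂ : ℝ → ℝ)
    (z₃ xhat y : ℝ → EuclideanSpace ℝ (Fin n)) : Prop where
  z₁_eq : ∀ t : ℝ, 0 ≤ t → HasDerivWithinAt z₁ (eta α x z₁ y t) (Ici 0) t
  z₂_eq : ∀ t : ℝ, 0 ≤ t → HasDerivWithinAt z₂ (mSignal α z₂ y t) (Ici 0) t
  z₃_eq : ∀ t : ℝ, 0 ≤ t → HasDerivWithinAt z₃ (filteredPosition α z₃ y t) (Ici 0) t
  xhat_eq : ∀ t : ℝ, 0 ≤ t →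
    HasDerivWithinAt xhat (estimatorRate α γ x z₁ z₂ z₃ xhat y t) (Ici 0) t
  y_eq : ∀ t : ℝ, 0 ≤ t →
    HasDerivWithinAt y
      (estimatorRate α γ x z₁ z₂ z₃ xhat y t
        - WithLp.toLp 2
            (((‖y t - xhat t‖ ^ 2 - d ^ 2) • (1 : Matrix (Fin n) (Fin n) ℝ) - A t)
              *ᵥ (y t - xhat t)))
      (Ici 0) t

end Circumnavigation

end

noncomputable section

namespace Circumnavigation

open MeasureTheory intervalIntegral Filter Topology

/-! ### Calculus on the half-line -/

/-! The control error `e = y - x̂` obeys `ė = -(‖e‖² - d²) e + A e`, free of the estimator. As `A`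
is skew, `‖e‖²` solves a Bernoulli equation whose reciprocal `p` is explicit and tends to `1 / d²`.
Hence `q = √p e` is a unit-norm solution of `q̇ = A q`, and `e - d q → 0`
(`exists_linearSolution_of_control`).

The energy `estimationEnergy` decreases, so `x̂`, `y` and `V` are bounded, which gives the upper
bound. Its decay rate controls the squared speed of `x̂`, so increments of `x̂` over a fixed step
tend to zero (`exists_norm_estimate_increment_le`); convergence of `x̂` is not needed. For large `s`
therefore `y (s + σ) - y s ≈ d (q (s + σ) - q s) ≈ σ d A(s) q(s)`.

Since `y = V + α z₃` and `ż₃ = V`, the left side paired with `θ` is expressed through `⟨θ, V⟩`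
alone. If `⟨θ, V⟩` were small in mean square on a long window, so would be `⟨θ, d A q⟩`, against
condition (iv) for `q` (`exists_le_integral_sq_inner_of_increments`). -/

lemma continuousOn_Ici_of_hasDerivWithinAt {E : Type*} [NormedAddCommGroup E] [NormedSpace ℝ E]
    {f f' : ℝ → E} (hf : ∀ t, 0 ≤ t → HasDerivWithinAt f (f' t) (Ici 0) t) :
    ContinuousOn f (Ici 0) :=
  fun t ht => (hf t ht).continuousWithinAt

lemma antitoneOn_Ici_of_hasDerivWithinAt {f f' : ℝ → ℝ}
    (hf : ∀ t, 0 ≤ t → HasDerivWithinAt f (f' t) (Ici 0) t) (hf' : ∀ t, 0 ≤ t → f' t ≤ 0) :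
    AntitoneOn f (Ici 0) := by
  refine antitoneOn_of_hasDerivWithinAt_nonpos (f' := f') (convex_Ici 0)
    (continuousOn_Ici_of_hasDerivWithinAt hf) (fun t ht => ?_) (fun t ht => ?_)
  · exact (hf t (interior_subset ht)).mono interior_subset
  · exact hf' t (interior_subset ht)

lemma norm_sub_le_of_hasDerivWithinAt_Ici {E : Type*} [NormedAddCommGroup E] [NormedSpace ℝ E]
    {f f' : ℝ → E} {B B' : ℝ → ℝ}
    (hf : ∀ t, 0 ≤ t → HasDerivWithinAt f (f' t) (Ici 0) t)
    (hB : ∀ t, 0 ≤ t → HasDerivWithinAt B (B' t) (Ici 0) t)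
    {a b : ℝ} (ha : 0 ≤ a) (hab : a ≤ b) (h : ∀ t ∈ Ico a b, ‖f' t‖ ≤ B' t) :
    ‖f b - f a‖ ≤ B b - B a := by
  have hsub : Icc a b ⊆ Ici 0 := fun t ht => ha.trans ht.1
  have key := image_norm_le_of_norm_deriv_right_le_deriv_boundary'
    (f := fun t => f t - f a) (f' := f') (B := fun t => B t - B a) (B' := B') (a := a) (b := b)
    (((continuousOn_Ici_of_hasDerivWithinAt hf).mono hsub).sub continuousOn_const)
    (fun t ht => ((hf t (ha.trans ht.1)).mono (Ici_subset_Ici.2 (ha.trans ht.1))).sub_const _)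
    (by simp)
    (((continuousOn_Ici_of_hasDerivWithinAt hB).mono hsub).sub continuousOn_const)
    (fun t ht => ((hB t (ha.trans ht.1)).mono (Ici_subset_Ici.2 (ha.trans ht.1))).sub_const _)
    h
  exact key (right_mem_Icc.2 hab)

lemma sub_eq_integral_of_hasDerivWithinAt_Ici {f f' : ℝ → ℝ}
    (hf : ∀ t, 0 ≤ t → HasDerivWithinAt f (f' t) (Ici 0) t) (hf' : ContinuousOn f' (Ici 0))
    {a b : ℝ} (ha : 0 ≤ a) (hab : a ≤ b) : f b - f a = ∫ t in a..b, f' t := by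
  have hsub : Icc a b ⊆ Ici 0 := fun t ht => ha.trans ht.1
  refine (integral_eq_sub_of_hasDeriv_right_of_le hab
    ((continuousOn_Ici_of_hasDerivWithinAt hf).mono hsub) (fun t ht => ?_)
    ((hf'.mono hsub).intervalIntegrable_of_Icc hab)).symm
  exact (hf t (ha.trans ht.1.le)).mono fun s hs => (ha.trans ht.1.le).trans (le_of_lt hs)

lemma intervalIntegrable_of_continuousOn_Ici {f : ℝ → ℝ} (hf : ContinuousOn f (Ici 0))
    {a b : ℝ} (ha : 0 ≤ a) (hab : a ≤ b) : IntervalIntegrable f volume a b :=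
  (hf.mono fun _ ht => ha.trans ht.1).intervalIntegrable_of_Icc hab

/-- Cauchy–Schwarz against the constant `1`, read off from the nonnegative variance of `f` about its
mean `I / σ`. -/
lemma sq_integral_le {f : ℝ → ℝ} (hf : ContinuousOn f (Ici 0)) {a σ : ℝ} (ha : 0 ≤ a)
    (hσ : 0 < σ) : (∫ t in a..a + σ, f t) ^ 2 ≤ σ * ∫ t in a..a + σ, f t ^ 2 := by
  have hab : a ≤ a + σ := by linarith
  set I := ∫ t in a..a + σ, f t with hI
  have i1 := intervalIntegrable_of_continuousOn_Ici hf ha hab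
  have i2 : IntervalIntegrable (fun t => f t ^ 2) volume a (a + σ) :=
    intervalIntegrable_of_continuousOn_Ici (hf.pow 2) ha hab
  have h0 : 0 ≤ ∫ t in a..a + σ, (f t - I / σ) ^ 2 :=
    integral_nonneg hab fun t _ => sq_nonneg _
  have h1 : ∫ t in a..a + σ, (f t - I / σ) ^ 2
      = (∫ t in a..a + σ, f t ^ 2) - I ^ 2 / σ := by
    have : ∀ t, (f t - I / σ) ^ 2 = f t ^ 2 - (2 * (I / σ)) * f t + (I / σ) ^ 2 := fun t => by ring
    simp_rw [this]
    rw [integral_add (i2.sub (i1.const_mul _)) intervalIntegrable_const,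
      integral_sub i2 (i1.const_mul _), intervalIntegral.integral_const_mul, ← hI]
    simp
    field_simp
    ring
  rw [h1, sub_nonneg, div_le_iff₀ hσ] at h0
  linarith

/-! ### Continuous periodic functions -/

/-- The function factors through the compact circle `ℝ / Tℤ`. -/
lemma uniformContinuous_of_periodic {E : Type*} [UniformSpace E] {f : ℝ → E} {T : ℝ}
    (hT : 0 < T) (hp : Function.Periodic f T) (hf : Continuous f) : UniformContinuous f := by
  have : Fact (0 < T) := ⟨hT⟩
  have hc : Continuous (hp.lift : AddCircle T → E) := continuous_coinduced_dom.2 hf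
  have h1 : UniformContinuous (hp.lift : AddCircle T → E) :=
    CompactSpace.uniformContinuous_of_continuous hc
  have h2 : UniformContinuous (QuotientAddGroup.mk' (AddSubgroup.zmultiples T)) :=
    uniformContinuous_addMonoidHom_of_continuous
      (f := QuotientAddGroup.mk' (AddSubgroup.zmultiples T)) continuous_quotient_mk'
  exact h1.comp h2

lemma exists_norm_le_of_periodic {E : Type*} [NormedAddCommGroup E] {f : ℝ → E} {T : ℝ}
    (hT : 0 < T) (hp : Function.Periodic f T) (hf : Continuous f) : ∃ C, ∀ t, ‖f t‖ ≤ C := by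
  obtain ⟨C, hC⟩ := (isCompact_Icc (a := 0) (b := T)).exists_bound_of_continuousOn hf.continuousOn
  refine ⟨C, fun t => ?_⟩
  obtain ⟨s, hs, h⟩ := hp.exists_mem_Ico₀ hT t
  rw [h]
  exact hC s (Ico_subset_Icc_self hs)

/-! ### Gramians as quadratic forms -/

lemma le_iff_dotProduct_mulVec {n : ℕ} {M N : Matrix (Fin n) (Fin n) ℝ} (hM : M.IsSymm)
    (hN : N.IsSymm) :
    M ≤ N ↔ ∀ θ : EuclideanSpace ℝ (Fin n), θ ⬝ᵥ (M *ᵥ θ) ≤ θ ⬝ᵥ (N *ᵥ θ) := by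
  rw [Matrix.le_iff, Matrix.posSemidef_iff_dotProduct_mulVec]
  have hH : (N - M).IsHermitian := by
    rw [Matrix.IsHermitian, Matrix.conjTranspose_eq_transpose_of_trivial]
    exact hN.sub hM
  constructor
  · intro h θ
    have := h.2 θ
    simpa [Matrix.sub_mulVec, dotProduct_sub] using this
  · intro h
    refine ⟨hH, fun θ => ?_⟩
    have := h (WithLp.toLp 2 θ)
    simpa [Matrix.sub_mulVec, dotProduct_sub] using this

lemma isSymm_gramian {n : ℕ} (v : ℝ → EuclideanSpace ℝ (Fin n)) (a b : ℝ) :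
    (gramian v a b).IsSymm := by
  ext i j
  simp [gramian, Matrix.vecMulVec_apply, mul_comm]

lemma dotProduct_smul_one_mulVec {n : ℕ} (c : ℝ) (θ : EuclideanSpace ℝ (Fin n)) :
    θ ⬝ᵥ ((c • (1 : Matrix (Fin n) (Fin n) ℝ)) *ᵥ θ) = c * ‖θ‖ ^ 2 := by
  rw [EuclideanSpace.real_norm_sq_eq]
  simp [Matrix.smul_mulVec, dotProduct, pow_two, Finset.mul_sum, mul_left_comm]

lemma dotProduct_gramian_mulVec {n : ℕ} {v : ℝ → EuclideanSpace ℝ (Fin n)}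
    (hv : ContinuousOn v (Ici 0)) {a b : ℝ} (ha : 0 ≤ a) (hab : a ≤ b)
    (θ : EuclideanSpace ℝ (Fin n)) :
    θ ⬝ᵥ (gramian v a b *ᵥ θ) = ∫ τ in a..b, inner ℝ θ (v τ) ^ 2 := by
  have hc : ∀ i, ContinuousOn (fun τ => v τ i) (Ici 0) := fun i =>
    (EuclideanSpace.proj (𝕜 := ℝ) i).continuous.comp_continuousOn hv
  have hint : ∀ i j, IntervalIntegrable (fun τ => θ i * (v τ i * v τ j * θ j)) volume a b :=
    fun i j => intervalIntegrable_of_continuousOn_Ici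
      (continuousOn_const.mul (((hc i).mul (hc j)).mul continuousOn_const)) ha hab
  have hpt : ∀ τ, inner ℝ θ (v τ) ^ 2 = ∑ i, ∑ j, θ i * (v τ i * v τ j * θ j) := by
    intro τ
    rw [PiLp.inner_apply, pow_two, Finset.sum_mul_sum]
    refine Finset.sum_congr rfl fun i _ => Finset.sum_congr rfl fun j _ => ?_
    simp
    ring
  simp_rw [hpt]
  have hsum : ∀ i, IntervalIntegrable (fun τ => ∑ j, θ i * (v τ i * v τ j * θ j)) volume a b :=
    fun i => intervalIntegrable_of_continuousOn_Ici (continuousOn_finsetSum _ fun j _ =>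
      continuousOn_const.mul (((hc i).mul (hc j)).mul continuousOn_const)) ha hab
  rw [intervalIntegral.integral_finsetSum fun i _ => hsum i]
  simp only [dotProduct, Matrix.mulVec, gramian, Matrix.of_apply, Matrix.vecMulVec_apply]
  refine Finset.sum_congr rfl fun i _ => ?_
  rw [intervalIntegral.integral_finsetSum fun j _ => hint i j, Finset.mul_sum]
  refine Finset.sum_congr rfl fun j _ => ?_
  rw [intervalIntegral.integral_const_mul, intervalIntegral.integral_mul_const]

lemma smul_one_le_gramian_iff {n : ℕ} {v : ℝ → EuclideanSpace ℝ (Fin n)}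
    (hv : ContinuousOn v (Ici 0)) {a b : ℝ} (ha : 0 ≤ a) (hab : a ≤ b) (c : ℝ) :
    c • (1 : Matrix (Fin n) (Fin n) ℝ) ≤ gramian v a b ↔
      ∀ θ : EuclideanSpace ℝ (Fin n), c * ‖θ‖ ^ 2 ≤ ∫ τ in a..b, inner ℝ θ (v τ) ^ 2 := by
  rw [le_iff_dotProduct_mulVec (Matrix.isSymm_one.smul c) (isSymm_gramian v a b)]
  simp_rw [dotProduct_smul_one_mulVec, dotProduct_gramian_mulVec hv ha hab]

lemma gramian_le_smul_one_iff {n : ℕ} {v : ℝ → EuclideanSpace ℝ (Fin n)}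
    (hv : ContinuousOn v (Ici 0)) {a b : ℝ} (ha : 0 ≤ a) (hab : a ≤ b) (c : ℝ) :
    gramian v a b ≤ c • (1 : Matrix (Fin n) (Fin n) ℝ) ↔
      ∀ θ : EuclideanSpace ℝ (Fin n), ∫ τ in a..b, inner ℝ θ (v τ) ^ 2 ≤ c * ‖θ‖ ^ 2 := by
  rw [le_iff_dotProduct_mulVec (isSymm_gramian v a b) (Matrix.isSymm_one.smul c)]
  simp_rw [dotProduct_smul_one_mulVec, dotProduct_gramian_mulVec hv ha hab]

/-! ### Transfer of persistent excitation -/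

lemma sq_le_four_mul_of_eq_add {x a b c e : ℝ} (h : x = a - b + c - e) :
    x ^ 2 ≤ 4 * (a ^ 2 + b ^ 2 + c ^ 2 + e ^ 2) := by
  subst h
  nlinarith [sq_nonneg (a + b), sq_nonneg (a - c), sq_nonneg (a + e), sq_nonneg (b + c),
    sq_nonneg (b - e), sq_nonneg (c + e)]

/-- If `V + α z`, with `ż = V`, has increments over a fixed step approximated uniformly for large
times by those of a signal with persistently spanning derivative `u`, then `V` is persistently
exciting. -/
lemma exists_le_integral_sq_inner_of_increments {n : ℕ}
    {V z u : ℝ → EuclideanSpace ℝ (Fin n)} {α a T : ℝ} (ha : 0 < a) (hT : 0 < T)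
    (hV : ContinuousOn V (Ici 0)) (hu : ContinuousOn u (Ici 0))
    (hz : ∀ t, 0 ≤ t → HasDerivWithinAt z (V t) (Ici 0) t)
    (hPE : ∀ t, 0 ≤ t → ∀ θ : EuclideanSpace ℝ (Fin n),
      a * ‖θ‖ ^ 2 ≤ ∫ τ in t..t + T, inner ℝ θ (u τ) ^ 2)
    (happ : ∀ κ, 0 < κ → ∃ σ, 0 < σ ∧ ∃ t₀, 0 ≤ t₀ ∧ ∀ s, t₀ ≤ s →
      ‖V (s + σ) - V s + α • (z (s + σ) - z s) - σ • u s‖ ≤ σ * κ) :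
    ∃ c T' : ℝ, 0 < c ∧ 0 < T' ∧ ∀ t, 0 ≤ t → ∀ θ : EuclideanSpace ℝ (Fin n),
      c * ‖θ‖ ^ 2 ≤ ∫ τ in t..t + T', inner ℝ θ (V τ) ^ 2 := by
  -- With this `κ` the approximation error `4 T σ² κ² ‖θ‖²` is half of the excitation `σ² a ‖θ‖²`;
  -- the other half is bounded by `(8 + 4 α² σ T) I`, whence the constant below. The window has
  -- length `t₀` to reach the asymptotic regime, `T` for the excitation of `u`, and `σ` for the
  -- look-ahead.
  set κ := √(a / (8 * T)) with hκ
  have hκ2 : κ ^ 2 = a / (8 * T) := Real.sq_sqrt (by positivity)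
  obtain ⟨σ, hσ, t₀, ht₀, hs⟩ := happ κ (by positivity)
  refine ⟨σ ^ 2 * a / 2 / (8 + 4 * α ^ 2 * σ * T), t₀ + T + σ, by positivity, by positivity,
    fun t ht θ => ?_⟩
  set t' := max t t₀ with ht'
  have htt' : t ≤ t' := le_max_left _ _
  have ht₀' : t₀ ≤ t' := le_max_right _ _
  have h0t' : 0 ≤ t' := ht.trans htt'
  have hend : t' + T + σ ≤ t + (t₀ + T + σ) := by
    have : t' ≤ t + t₀ := max_le (by linarith) (by linarith)
    linarith
  set v : ℝ → ℝ := fun s => inner ℝ θ (V s) with hv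
  set g : ℝ → ℝ := fun s => inner ℝ θ (u s) with hg
  have hvc : ContinuousOn v (Ici 0) := continuousOn_const.inner hV
  have hgc : ContinuousOn g (Ici 0) := continuousOn_const.inner hu
  have hv2 : ContinuousOn (fun s => v s ^ 2) (Ici 0) := hvc.pow 2
  have hmono : ∀ p q p' q' : ℝ, 0 ≤ p' → p' ≤ p → p ≤ q → q ≤ q' →
      ∫ τ in p..q, v τ ^ 2 ≤ ∫ τ in p'..q', v τ ^ 2 := fun p q p' q' h0 h1 h2 h3 =>
    integral_mono_interval h1 h2 h3 (ae_of_all _ fun _ => sq_nonneg _)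
      (intervalIntegrable_of_continuousOn_Ici hv2 h0 (h1.trans (h2.trans h3)))
  set I := ∫ τ in t'..t' + T + σ, v τ ^ 2 with hI
  have hpt : ∀ s ∈ Icc t' (t' + T), σ ^ 2 * g s ^ 2
      ≤ 4 * (v (s + σ) ^ 2 + v s ^ 2 + (α ^ 2 * (σ * I) + σ ^ 2 * κ ^ 2 * ‖θ‖ ^ 2)) := by
    intro s hsI
    have h0s : 0 ≤ s := h0t'.trans hsI.1
    set J := ∫ τ in s..s + σ, v τ with hJ
    -- Because `ż = V`, the increment of `z` is also controlled by the mean square of `v`.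
    have hzJ : inner ℝ θ (z (s + σ) - z s) = J := by
      rw [hJ, ← sub_eq_integral_of_hasDerivWithinAt_Ici (f := fun s => inner ℝ θ (z s))
        (fun τ hτ => ?_) hvc h0s (by linarith), inner_sub_right]
      exact (innerSL ℝ θ).hasFDerivAt.comp_hasDerivWithinAt τ (hz τ hτ)
    have hJ2 : J ^ 2 ≤ σ * I := (sq_integral_le hvc h0s hσ).trans
      (mul_le_mul_of_nonneg_left
        (hmono _ _ _ _ h0t' hsI.1 (by linarith) (by linarith [hsI.2])) hσ.le)
    set w := V (s + σ) - V s + α • (z (s + σ) - z s) - σ • u s with hw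
    have hin : inner ℝ θ w = v (s + σ) - v s + α * J - σ * g s := by
      rw [hw, inner_sub_right, inner_add_right, inner_sub_right, inner_smul_right,
        inner_smul_right, hzJ]
    have hwn : (inner ℝ θ w) ^ 2 ≤ σ ^ 2 * κ ^ 2 * ‖θ‖ ^ 2 := by
      have h1 : |inner ℝ θ w| ≤ ‖θ‖ * (σ * κ) := (abs_real_inner_le_norm _ _).trans
        (mul_le_mul_of_nonneg_left (hs s (ht₀'.trans hsI.1)) (norm_nonneg _))
      calc (inner ℝ θ w) ^ 2 = |inner ℝ θ w| ^ 2 := (sq_abs _).symm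
        _ ≤ (‖θ‖ * (σ * κ)) ^ 2 := pow_le_pow_left₀ (abs_nonneg _) h1 2
        _ = _ := by ring
    have h4 := sq_le_four_mul_of_eq_add (x := σ * g s) (a := v (s + σ)) (b := v s) (c := α * J)
      (e := inner ℝ θ w) (by rw [hin]; ring)
    have h5 : (α * J) ^ 2 ≤ α ^ 2 * (σ * I) := by
      rw [mul_pow]
      exact mul_le_mul_of_nonneg_left hJ2 (sq_nonneg _)
    rw [mul_pow] at h4
    linarith
  have hab : t' ≤ t' + T := by linarith
  have i1 : IntervalIntegrable (fun s => v (s + σ) ^ 2) volume t' (t' + T) :=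
    intervalIntegrable_of_continuousOn_Ici
      (hv2.comp (g := fun s => v s ^ 2) (f := fun s => s + σ) (by fun_prop)
        fun s (hs0 : 0 ≤ s) => (by linarith : (0 : ℝ) ≤ s + σ)) h0t' hab
  have i2 : IntervalIntegrable (fun s => v s ^ 2) volume t' (t' + T) :=
    intervalIntegrable_of_continuousOn_Ici hv2 h0t' hab
  have hint := integral_mono_on hab
    (((intervalIntegrable_of_continuousOn_Ici (hgc.pow 2) h0t' hab).const_mul (σ ^ 2)))
    (((i1.add i2).add intervalIntegrable_const).const_mul 4) hpt
  have hR : ∫ s in t'..t' + T,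
      4 * (v (s + σ) ^ 2 + v s ^ 2 + (α ^ 2 * (σ * I) + σ ^ 2 * κ ^ 2 * ‖θ‖ ^ 2))
      = 4 * ((∫ s in (t' + σ)..(t' + T + σ), v s ^ 2) + (∫ s in t'..t' + T, v s ^ 2)
        + T * (α ^ 2 * (σ * I) + σ ^ 2 * κ ^ 2 * ‖θ‖ ^ 2)) := by
    rw [intervalIntegral.integral_const_mul, integral_add (i1.add i2) intervalIntegrable_const,
      integral_add i1 i2, integral_comp_add_right (fun s => v s ^ 2)]
    simp
    ring
  have hL : ∫ s in t'..t' + T, σ ^ 2 * (g ^ 2) s = σ ^ 2 * ∫ s in t'..t' + T, g s ^ 2 :=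
    intervalIntegral.integral_const_mul _ _
  have hint' : σ ^ 2 * ∫ s in t'..t' + T, g s ^ 2 ≤ _ := hL ▸ hint.trans hR.le
  have hm1 := hmono (t' + σ) (t' + T + σ) t' (t' + T + σ) h0t' (by linarith) (by linarith) le_rfl
  have hm2 := hmono t' (t' + T) t' (t' + T + σ) h0t' le_rfl hab (by linarith)
  have hm3 := hmono t' (t' + T + σ) t (t + (t₀ + T + σ)) ht htt' (by linarith) hend
  have hPE' := mul_le_mul_of_nonneg_left (hPE t' h0t' θ) (sq_nonneg σ)
  have hκT : T * (σ ^ 2 * κ ^ 2 * ‖θ‖ ^ 2) = σ ^ 2 * a * ‖θ‖ ^ 2 / 8 := by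
    rw [hκ2]
    field_simp
  refine le_trans ?_ hm3
  rw [div_mul_eq_mul_div, div_le_iff₀ (by positivity)]
  nlinarith

/-! ### Stable filters and Lyapunov functions -/

/-- With the integrating factor `exp (α t)` the derivative becomes `exp (α t) • y`, dominated by
that of `M / α * exp (α t)`. -/
lemma norm_le_of_stable_filter {E : Type*} [NormedAddCommGroup E] [NormedSpace ℝ E] {α M : ℝ}
    (hα : 0 < α) {z y : ℝ → E}
    (hz : ∀ t, 0 ≤ t → HasDerivWithinAt z (-α • z t + y t) (Ici 0) t)
    (hy : ∀ t, 0 ≤ t → ‖y t‖ ≤ M) {t : ℝ} (ht : 0 ≤ t) : ‖z t‖ ≤ ‖z 0‖ + M / α := by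
  have hexp : ∀ s, HasDerivAt (fun s => Real.exp (α * s)) (Real.exp (α * s) * α) s := fun s => by
    simpa using ((hasDerivAt_id s).const_mul α).exp
  have hM : 0 ≤ M := (norm_nonneg _).trans (hy 0 le_rfl)
  have hg : ∀ s, 0 ≤ s → HasDerivWithinAt (fun s => Real.exp (α * s) • z s)
      (Real.exp (α * s) • y s) (Ici 0) s := fun s hs => by
    refine ((hexp s).hasDerivWithinAt.smul (hz s hs)).congr_deriv ?_
    module
  have hB : ∀ s, 0 ≤ s → HasDerivWithinAt (fun s => M / α * Real.exp (α * s))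
      (Real.exp (α * s) * M) (Ici 0) s := fun s _ => by
    refine ((hexp s).const_mul (M / α)).hasDerivWithinAt.congr_deriv ?_
    field_simp
  have key := norm_sub_le_of_hasDerivWithinAt_Ici hg hB le_rfl ht fun s hs => by
    rw [norm_smul, Real.norm_of_nonneg (Real.exp_pos _).le]
    exact mul_le_mul_of_nonneg_left (hy s hs.1) (Real.exp_pos _).le
  have h1 : 1 ≤ Real.exp (α * t) := Real.one_le_exp (by positivity)
  have h2 := norm_le_norm_add_norm_sub' (Real.exp (α * t) • z t) (Real.exp (α * 0) • z 0)
  simp only [mul_zero, Real.exp_zero, one_smul, mul_one] at key h2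
  rw [norm_smul, Real.norm_of_nonneg (Real.exp_pos _).le] at h2
  have h3 : 0 ≤ M / α := by positivity
  have h4 : Real.exp (α * t) * ‖z t‖ ≤ Real.exp (α * t) * (‖z 0‖ + M / α) := by
    nlinarith [norm_nonneg (z 0)]
  exact le_of_mul_le_mul_left h4 (Real.exp_pos _)

lemma exists_sub_lt_of_antitoneOn {W : ℝ → ℝ} (hW : AntitoneOn W (Ici 0))
    (h0 : ∀ t, 0 ≤ W t) {ε : ℝ} (hε : 0 < ε) :
    ∃ t₀, 0 ≤ t₀ ∧ ∀ s t, t₀ ≤ s → s ≤ t → W s - W t < ε := by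
  have hne : (W '' Ici 0).Nonempty := ⟨W 0, 0, self_mem_Ici, rfl⟩
  have hbdd : BddBelow (W '' Ici 0) := ⟨0, by rintro _ ⟨t, _, rfl⟩; exact h0 t⟩
  obtain ⟨_, ⟨t₀, ht₀, rfl⟩, h⟩ := exists_lt_of_csInf_lt hne (lt_add_of_pos_right _ hε)
  refine ⟨t₀, ht₀, fun s t hs hst => ?_⟩
  have hs0 : 0 ≤ s := le_trans ht₀ hs
  have h1 := hW ht₀ hs0 hs
  have h2 := csInf_le hbdd ⟨t, hs0.trans hst, rfl⟩
  linarith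

/-- If the speed of `f` is controlled by the square root of the decay rate of a nonnegative
function, then the increments of `f` over a fixed step tend to zero. -/
lemma exists_norm_increment_le {E : Type*} [NormedAddCommGroup E] [NormedSpace ℝ E]
    {f f' : ℝ → E} {W W' : ℝ → ℝ} {C : ℝ} (hC : 0 ≤ C)
    (hf : ∀ t, 0 ≤ t → HasDerivWithinAt f (f' t) (Ici 0) t)
    (hW : ∀ t, 0 ≤ t → HasDerivWithinAt W (W' t) (Ici 0) t) (hW0 : ∀ t, 0 ≤ W t)
    (hW' : ∀ t, 0 ≤ t → W' t ≤ 0) (hfW : ∀ t, 0 ≤ t → ‖f' t‖ ^ 2 ≤ C * -W' t)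
    {σ κ : ℝ} (hσ : 0 < σ) (hκ : 0 < κ) :
    ∃ t₀, 0 ≤ t₀ ∧ ∀ s, t₀ ≤ s → ‖f (s + σ) - f s‖ ≤ κ := by
  -- Young's inequality gives `‖f'‖ ≤ l + ‖f'‖² / (4 l) ≤ l - K W'`. Over a step this integrates to
  -- `l σ = κ / 2` plus `K` times the drop of `W`, which is eventually at most `κ / 2`. The `K + 1`
  -- in the choice of `ε` covers `K = 0`.
  set l := κ / (2 * σ) with hl
  have hl0 : 0 < l := by positivity
  have hlσ : l * σ = κ / 2 := by rw [hl]; field_simp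
  set K := C / (4 * l) with hK
  have hK0 : 0 ≤ K := by positivity
  obtain ⟨t₀, ht₀, h⟩ := exists_sub_lt_of_antitoneOn (antitoneOn_Ici_of_hasDerivWithinAt hW hW')
    hW0 (ε := κ / (2 * (K + 1))) (by positivity)
  refine ⟨t₀, ht₀, fun s hs => ?_⟩
  have hB : ∀ t, 0 ≤ t → HasDerivWithinAt (fun t => l * t - K * W t) (l - K * W' t) (Ici 0) t :=
    fun t ht => by
      exact (((hasDerivWithinAt_id t _).const_mul l).sub ((hW t ht).const_mul K)).congr_deriv
        (by ring)
  have key := norm_sub_le_of_hasDerivWithinAt_Ici hf hB (ht₀.trans hs)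
    (le_add_of_nonneg_right hσ.le) fun t ht => by
      have h1 := hfW t (ht₀.trans (hs.trans ht.1))
      have h2 : K * -W' t = (C * -W' t) / (4 * l) := by rw [hK]; ring
      have h3 : ‖f' t‖ - l ≤ (C * -W' t) / (4 * l) := by
        rw [le_div_iff₀ (by positivity)]
        nlinarith [sq_nonneg (‖f' t‖ - 2 * l)]
      linarith
  have h5 := h s (s + σ) hs (by linarith)
  have h6 : K * (W s - W (s + σ)) ≤ κ / 2 := by
    have h7 : K * (W s - W (s + σ)) ≤ K * (κ / (2 * (K + 1))) :=
      mul_le_mul_of_nonneg_left h5.le hK0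
    have h8 : K * (κ / (2 * (K + 1))) ≤ κ / 2 := by
      rw [mul_div_assoc', div_le_div_iff₀ (by positivity) (by positivity)]
      nlinarith
    linarith
  linarith

/-! ### The control error -/

/-- The solution of `ṗ = 2 - 2 d² p` with initial value `1 / r₀`, the reciprocal of the squared
estimated distance. -/
def reciprocalSqDist (d r₀ t : ℝ) : ℝ :=
  1 / d ^ 2 + (1 / r₀ - 1 / d ^ 2) * Real.exp (-(2 * d ^ 2) * t)

section reciprocalSqDist

variable {d r₀ : ℝ}

lemma hasDerivAt_reciprocalSqDist (hd : 0 < d) (t : ℝ) :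
    HasDerivAt (reciprocalSqDist d r₀) (2 - 2 * d ^ 2 * reciprocalSqDist d r₀ t) t := by
  have h : HasDerivAt (fun s => Real.exp (-(2 * d ^ 2) * s))
      (Real.exp (-(2 * d ^ 2) * t) * -(2 * d ^ 2)) t := by
    simpa using ((hasDerivAt_id t).const_mul (-(2 * d ^ 2))).exp
  refine ((h.const_mul (1 / r₀ - 1 / d ^ 2)).const_add (1 / d ^ 2)).congr_deriv ?_
  rw [reciprocalSqDist]
  field_simp
  ring

/-- The value is a convex combination of `1 / d²` and `1 / r₀`, each at least `1 / (d² + r₀)`. -/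
lemma one_le_reciprocalSqDist_mul (hd : 0 < d) (hr : 0 < r₀) {t : ℝ} (ht : 0 ≤ t) :
    1 ≤ reciprocalSqDist d r₀ t * (d ^ 2 + r₀) := by
  have h0 := Real.exp_pos (-(2 * d ^ 2) * t)
  have h1 : Real.exp (-(2 * d ^ 2) * t) ≤ 1 := Real.exp_le_one_iff.2 (by
    nlinarith [mul_nonneg (sq_nonneg d) ht])
  set E := Real.exp (-(2 * d ^ 2) * t) with hE
  have : reciprocalSqDist d r₀ t * (d ^ 2 + r₀)
      = 1 + ((1 - E) * (r₀ / d ^ 2) + E * (d ^ 2 / r₀)) := by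
    rw [reciprocalSqDist, ← hE]
    field_simp
    ring
  rw [this]
  have : 0 ≤ (1 - E) * (r₀ / d ^ 2) := mul_nonneg (by linarith) (by positivity)
  have : 0 ≤ E * (d ^ 2 / r₀) := by positivity
  linarith

lemma reciprocalSqDist_pos (hd : 0 < d) (hr : 0 < r₀) {t : ℝ} (ht : 0 ≤ t) :
    0 < reciprocalSqDist d r₀ t :=
  pos_of_mul_pos_left (zero_lt_one.trans_le (one_le_reciprocalSqDist_mul hd hr ht))
    (by positivity)

lemma tendsto_reciprocalSqDist (hd : 0 < d) :
    Tendsto (reciprocalSqDist d r₀) atTop (𝓝 (1 / d ^ 2)) := by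
  have h : Tendsto (fun t => Real.exp (-(2 * d ^ 2) * t)) atTop (𝓝 0) :=
    Real.tendsto_exp_atBot.comp (tendsto_id.const_mul_atTop_of_neg (by
      have : 0 < d ^ 2 := by positivity
      linarith))
  have h' := (h.const_mul (1 / r₀ - 1 / d ^ 2)).const_add (1 / d ^ 2)
  rwa [mul_zero, add_zero] at h'

end reciprocalSqDist

lemma inner_mulVec_self_of_skew {n : ℕ} {M : Matrix (Fin n) (Fin n) ℝ} (hM : Mᵀ = -M)
    (v : EuclideanSpace ℝ (Fin n)) : inner ℝ v (WithLp.toLp 2 (M *ᵥ v)) = 0 := by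
  have h1 : inner ℝ v (WithLp.toLp 2 (M *ᵥ v)) = v.ofLp ⬝ᵥ (M *ᵥ v.ofLp) := by
    rw [EuclideanSpace.inner_eq_star_dotProduct]
    simp [dotProduct_comm]
  have h2 : v.ofLp ⬝ᵥ (M *ᵥ v.ofLp) = -(v.ofLp ⬝ᵥ (M *ᵥ v.ofLp)) := by
    conv_lhs => rw [Matrix.dotProduct_mulVec, ← Matrix.mulVec_transpose, hM, Matrix.neg_mulVec,
      neg_dotProduct, dotProduct_comm]
  rw [h1]
  linarith

section ControlError

variable {n : ℕ} {d : ℝ} {A : ℝ → Matrix (Fin n) (Fin n) ℝ} {e : ℝ → EuclideanSpace ℝ (Fin n)}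

/-- Put `h = ‖e‖² p - 1`. Then `ḣ = -2 ‖e‖² h`, so `h²` is nonincreasing and starts at `0`. Nothing
is divided by `‖e t‖`, so nonvanishing of `e` is a consequence and not a prerequisite. -/
lemma sq_norm_mul_reciprocalSqDist (hd : 0 < d) (hA : ∀ t, (A t)ᵀ = -A t) (h0 : 0 < ‖e 0‖)
    (he : ∀ t, 0 ≤ t → HasDerivWithinAt e
      (-(‖e t‖ ^ 2 - d ^ 2) • e t + WithLp.toLp 2 (A t *ᵥ e t)) (Ici 0) t)
    {t : ℝ} (ht : 0 ≤ t) : ‖e t‖ ^ 2 * reciprocalSqDist d (‖e 0‖ ^ 2) t = 1 := by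
  set p := reciprocalSqDist d (‖e 0‖ ^ 2) with hp
  have hr : ∀ s, 0 ≤ s → HasDerivWithinAt (fun s => ‖e s‖ ^ 2)
      (-2 * (‖e s‖ ^ 2 - d ^ 2) * ‖e s‖ ^ 2) (Ici 0) s := fun s hs => by
    refine (he s hs).norm_sq.congr_deriv ?_
    rw [inner_add_right, inner_smul_right, inner_mulVec_self_of_skew (hA s),
      real_inner_self_eq_norm_sq]
    ring
  have hf : ∀ s, 0 ≤ s → HasDerivWithinAt (fun s => (‖e s‖ ^ 2 * p s - 1) ^ 2)
      (-4 * ‖e s‖ ^ 2 * (‖e s‖ ^ 2 * p s - 1) ^ 2) (Ici 0) s := fun s hs => by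
    refine ((((hr s hs).mul (hasDerivAt_reciprocalSqDist hd s).hasDerivWithinAt).sub_const 1).pow
      2).congr_deriv ?_
    simp only [← hp, Pi.mul_apply]
    push_cast
    ring
  have hanti := antitoneOn_Ici_of_hasDerivWithinAt hf fun s _ => by
    have := mul_nonneg (sq_nonneg ‖e s‖) (sq_nonneg (‖e s‖ ^ 2 * p s - 1))
    linarith
  have h1 := hanti self_mem_Ici ht ht
  have h2 : ‖e 0‖ ^ 2 * p 0 - 1 = 0 := by
    simp [hp, reciprocalSqDist, h0.ne']
  simp only [h2] at h1
  have h3 : ‖e t‖ ^ 2 * p t - 1 = 0 := by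
    have := sq_nonneg (‖e t‖ ^ 2 * p t - 1)
    exact pow_eq_zero_iff (two_ne_zero) |>.1 (by linarith)
  linarith

lemma sq_norm_le_of_control (hd : 0 < d) (hA : ∀ t, (A t)ᵀ = -A t) (h0 : 0 < ‖e 0‖)
    (he : ∀ t, 0 ≤ t → HasDerivWithinAt e
      (-(‖e t‖ ^ 2 - d ^ 2) • e t + WithLp.toLp 2 (A t *ᵥ e t)) (Ici 0) t)
    {t : ℝ} (ht : 0 ≤ t) : ‖e t‖ ^ 2 ≤ d ^ 2 + ‖e 0‖ ^ 2 := by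
  have h1 := sq_norm_mul_reciprocalSqDist hd hA h0 he ht
  have h2 := one_le_reciprocalSqDist_mul hd (pow_pos h0 2) ht
  calc ‖e t‖ ^ 2 ≤ ‖e t‖ ^ 2 * (reciprocalSqDist d (‖e 0‖ ^ 2) t * (d ^ 2 + ‖e 0‖ ^ 2)) :=
        le_mul_of_one_le_right (sq_nonneg _) h2
    _ = d ^ 2 + ‖e 0‖ ^ 2 := by rw [← mul_assoc, h1, one_mul]

/-- The control error is asymptotic to `d` times a unit-norm solution of `q̇ = A q`. -/
lemma exists_linearSolution_of_control (hd : 0 < d) (hA : ∀ t, (A t)ᵀ = -A t) (h0 : 0 < ‖e 0‖)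
    (he : ∀ t, 0 ≤ t → HasDerivWithinAt e
      (-(‖e t‖ ^ 2 - d ^ 2) • e t + WithLp.toLp 2 (A t *ᵥ e t)) (Ici 0) t) :
    ∃ q, IsLinearSolution A q ∧ (∀ t, 0 ≤ t → ‖q t‖ = 1) ∧
      Tendsto (fun t => e t - d • q t) atTop (𝓝 0) := by
  set p := reciprocalSqDist d (‖e 0‖ ^ 2) with hp
  have hp0 : ∀ t, 0 ≤ t → 0 < p t := fun t ht => reciprocalSqDist_pos hd (pow_pos h0 2) ht
  have hpr : ∀ t, 0 ≤ t → ‖e t‖ ^ 2 * p t = 1 := fun t ht =>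
    sq_norm_mul_reciprocalSqDist hd hA h0 he ht
  have hnorm : ∀ t, 0 ≤ t → ‖√(p t) • e t‖ = 1 := fun t ht => by
    rw [norm_smul, Real.norm_of_nonneg (Real.sqrt_nonneg _), ← sq_eq_sq₀ (by positivity) one_pos.le,
      mul_pow, Real.sq_sqrt (hp0 t ht).le, mul_comm, hpr t ht, one_pow]
  refine ⟨fun t => √(p t) • e t, fun t ht => ?_, hnorm, ?_⟩
  · have hs := Real.sqrt_pos.2 (hp0 t ht)
    have hsq := Real.sq_sqrt (hp0 t ht).le
    refine (((hasDerivAt_reciprocalSqDist hd t).hasDerivWithinAt.sqrt (hp0 t ht).ne').smul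
      (he t ht)).congr_deriv ?_
    rw [← hp]
    have hA' : WithLp.toLp 2 (A t *ᵥ (√(p t) • e t).ofLp)
        = √(p t) • WithLp.toLp 2 (A t *ᵥ e t) := by
      rw [WithLp.ofLp_smul, Matrix.mulVec_smul, WithLp.toLp_smul]
    -- The radial part of `q̇` cancels because `‖e‖² p = 1`, leaving only `A q`.
    have hc : √(p t) * -(‖e t‖ ^ 2 - d ^ 2) + (2 - 2 * d ^ 2 * p t) / (2 * √(p t)) = 0 := by
      have h1 := hpr t ht
      rw [← hsq] at h1
      rw [← hsq, Real.sqrt_sq hs.le]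
      field_simp
      linear_combination -h1
    rw [hA', smul_add, smul_smul, add_right_comm, ← add_smul, hc, zero_smul, zero_add]
  · have hlim : Tendsto (fun t => 1 / √(p t) - d) atTop (𝓝 0) := by
      have h1 : Tendsto (fun t => √(p t)) atTop (𝓝 (1 / d)) := by
        have := (tendsto_reciprocalSqDist (r₀ := ‖e 0‖ ^ 2) hd).sqrt
        rwa [← one_div_pow, Real.sqrt_sq (by positivity)] at this
      have h2 := (tendsto_const_nhds (x := (1 : ℝ))).div h1 (by positivity)
      simpa using h2.sub_const d
    rw [tendsto_zero_iff_norm_tendsto_zero]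
    refine (tendsto_zero_iff_norm_tendsto_zero.1 hlim).congr' ?_
    filter_upwards [eventually_ge_atTop 0] with t ht
    have hs := Real.sqrt_pos.2 (hp0 t ht)
    have : e t - d • √(p t) • e t = (1 / √(p t) - d) • √(p t) • e t := by
      rw [sub_smul, smul_smul (1 / √(p t)), one_div_mul_cancel hs.ne', one_smul]
    rw [this, norm_smul, hnorm t ht, mul_one]

end ControlError

/-! ### Unit-norm solutions of the linear system -/

section LinearSolution

variable {n : ℕ} {A : ℝ → Matrix (Fin n) (Fin n) ℝ} {q : ℝ → EuclideanSpace ℝ (Fin n)}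

lemma AdmissibleMatrix.continuous (hA : AdmissibleMatrix A) : Continuous A :=
  continuous_matrix fun i j => (hA.differentiable i j).continuous

lemma continuous_toEuclideanCLM_comp (hA : Continuous A) :
    Continuous fun t => Matrix.toEuclideanCLM (n := Fin n) (𝕜 := ℝ) (A t) := by
  have h : Continuous (Matrix.toEuclideanCLM (n := Fin n) (𝕜 := ℝ)).toAlgEquiv.toLinearMap :=
    LinearMap.continuous_of_finiteDimensional _
  exact h.comp hA

lemma IsLinearSolution.continuousOn_deriv (hA : Continuous A) (hq : IsLinearSolution A q) :
    ContinuousOn (fun t => WithLp.toLp 2 (A t *ᵥ q t)) (Ici 0) :=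
  ((continuous_toEuclideanCLM_comp hA).continuousOn).clm_apply
    (continuousOn_Ici_of_hasDerivWithinAt hq)

lemma IsLinearSolution.derivWithin_eq (hq : IsLinearSolution A q) {t : ℝ} (ht : 0 ≤ t) :
    derivWithin q (Ici 0) t = WithLp.toLp 2 (A t *ᵥ q t) :=
  (hq t ht).derivWithin (uniqueDiffOn_Ici 0 t ht)

/-- A first-order expansion with one step `σ` for all `s`: `A` is uniformly continuous and bounded
by periodicity, and `q` is bounded and Lipschitz, so `A q` is uniformly continuous. -/
lemma IsLinearSolution.exists_norm_increment_sub_le (hA : AdmissibleMatrix A)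
    (hq : IsLinearSolution A q) (hq1 : ∀ t, 0 ≤ t → ‖q t‖ = 1) {κ : ℝ} (hκ : 0 < κ) :
    ∃ σ, 0 < σ ∧ ∀ s, 0 ≤ s →
      ‖q (s + σ) - q s - σ • WithLp.toLp 2 (A s *ᵥ q s)‖ ≤ σ * κ := by
  obtain ⟨T, hT, hper⟩ := hA.periodic
  set L : ℝ → EuclideanSpace ℝ (Fin n) →L[ℝ] EuclideanSpace ℝ (Fin n) :=
    fun t => Matrix.toEuclideanCLM (n := Fin n) (𝕜 := ℝ) (A t) with hL
  have hLc : Continuous L := continuous_toEuclideanCLM_comp hA.continuous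
  have hLp : Function.Periodic L T := fun t => by simp only [hL, hper]
  obtain ⟨C, hC⟩ := exists_norm_le_of_periodic hT hLp hLc
  have hC0 : 0 ≤ C := (norm_nonneg _).trans (hC 0)
  obtain ⟨δ, hδ, hLδ⟩ := Metric.uniformContinuous_iff.1
    (uniformContinuous_of_periodic hT hLp hLc) (κ / 2) (by positivity)
  have hq' : ∀ t, 0 ≤ t → HasDerivWithinAt q (L t (q t)) (Ici 0) t := hq
  have hLq : ∀ t, 0 ≤ t → ‖L t (q t)‖ ≤ C := fun t ht => by
    simpa [hq1 t ht] using (L t).le_of_opNorm_le (hC t) (q t)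
  -- The first bound keeps the variation of `A` below `κ / 2`, the second that of `q`, which
  -- contributes at most `C² σ`.
  set σ := min (δ / 2) (κ / (2 * (C ^ 2 + 1))) with hσ
  have hσ0 : 0 < σ := by positivity
  have hσδ : σ < δ := (min_le_left _ _).trans_lt (by linarith)
  have hσC : C ^ 2 * σ ≤ κ / 2 := by
    have h1 : C ^ 2 * σ ≤ C ^ 2 * (κ / (2 * (C ^ 2 + 1))) :=
      mul_le_mul_of_nonneg_left (min_le_right _ _) (sq_nonneg C)
    have h2 : C ^ 2 * (κ / (2 * (C ^ 2 + 1))) ≤ κ / 2 := by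
      rw [mul_div_assoc', div_le_div_iff₀ (by positivity) (by norm_num)]
      nlinarith
    exact h1.trans h2
  refine ⟨σ, hσ0, fun s hs => ?_⟩
  have hlip : ∀ t ∈ Ico s (s + σ), ‖q t - q s‖ ≤ C * σ := fun t ht => by
    have h1 := norm_sub_le_of_hasDerivWithinAt_Ici hq'
      (B := fun t => C * t) (B' := fun _ => C)
      (fun t _ => by simpa using (hasDerivWithinAt_id t (Ici 0)).const_mul C) hs ht.1
      fun τ hτ => hLq τ (hs.trans hτ.1)
    nlinarith [ht.2]
  have hvar : ∀ t ∈ Ico s (s + σ), ‖L t (q t) - L s (q s)‖ ≤ κ := fun t ht => by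
    have hd : ‖L t - L s‖ ≤ κ / 2 := by
      rw [← dist_eq_norm]
      refine (hLδ ?_).le
      rw [Real.dist_eq, abs_of_nonneg (by linarith [ht.1])]
      linarith [ht.2]
    have h1 : ‖(L t - L s) (q t)‖ ≤ κ / 2 := by
      simpa [hq1 t (hs.trans ht.1)] using (L t - L s).le_of_opNorm_le hd (q t)
    have h2 : ‖L s (q t - q s)‖ ≤ C * (C * σ) :=
      ((L s).le_of_opNorm_le (hC s) _).trans (mul_le_mul_of_nonneg_left (hlip t ht) hC0)
    have h3 : L t (q t) - L s (q s) = (L t - L s) (q t) + L s (q t - q s) := by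
      simp
    rw [h3]
    refine (norm_add_le _ _).trans ?_
    nlinarith
  have key := norm_sub_le_of_hasDerivWithinAt_Ici
    (f := fun t => q t - t • L s (q s)) (f' := fun t => L t (q t) - L s (q s))
    (B := fun t => κ * t) (B' := fun _ => κ)
    (fun t ht => ((hq' t ht).sub
      ((hasDerivWithinAt_id t (Ici 0)).smul_const (L s (q s)))).congr_deriv (by simp))
    (fun t _ => by simpa using (hasDerivWithinAt_id t (Ici 0)).const_mul κ)
    hs (le_add_of_nonneg_right hσ0.le) hvar
  have hrw : q (s + σ) - q s - σ • WithLp.toLp 2 (A s *ᵥ q s)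
      = q (s + σ) - (s + σ) • L s (q s) - (q s - s • L s (q s)) := by
    have : WithLp.toLp 2 (A s *ᵥ q s) = L s (q s) := rfl
    rw [this]
    module
  rw [hrw]
  refine key.trans (le_of_eq ?_)
  ring

end LinearSolution

/-! ### The closed-loop signals -/

/-- The mismatch `η - m + Vᵀ x` between the filtered measurements and the source position. -/
def sourceMismatch {n : ℕ} (α : ℝ) (x : EuclideanSpace ℝ (Fin n)) (z₁ z₂ : ℝ → ℝ)
    (z₃ y : ℝ → EuclideanSpace ℝ (Fin n)) (t : ℝ) : ℝ :=
  eta α x z₁ y t - mSignal α z₂ y t + inner ℝ (filteredPosition α z₃ y t) x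

/-- The Lyapunov function `‖x̂ - x‖² + γ ε² / (2 α)`, with `ε` the source mismatch. -/
def estimationEnergy {n : ℕ} (α γ : ℝ) (x : EuclideanSpace ℝ (Fin n)) (z₁ z₂ : ℝ → ℝ)
    (z₃ xhat y : ℝ → EuclideanSpace ℝ (Fin n)) (t : ℝ) : ℝ :=
  ‖xhat t - x‖ ^ 2 + γ / (2 * α) * sourceMismatch α x z₁ z₂ z₃ y t ^ 2

namespace IsTrajectory

variable {n : ℕ} {α γ d : ℝ} {A : ℝ → Matrix (Fin n) (Fin n) ℝ} {x : EuclideanSpace ℝ (Fin n)}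
  {z₁ z₂ : ℝ → ℝ} {z₃ xhat y : ℝ → EuclideanSpace ℝ (Fin n)}

/-- All terms in `y` cancel on expanding `‖y - x‖²`. What remains is a constant minus `α (z₁ - z₂ +
z₃ᵀ x)`, and the bracket has the mismatch itself as derivative. -/
lemma hasDerivWithinAt_sourceMismatch (h : IsTrajectory α γ d A x z₁ z₂ z₃ xhat y) {t : ℝ}
    (ht : 0 ≤ t) :
    HasDerivWithinAt (sourceMismatch α x z₁ z₂ z₃ y)
      (-α * sourceMismatch α x z₁ z₂ z₃ y t) (Ici 0) t := by
  have heq : sourceMismatch α x z₁ z₂ z₃ y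
      = fun t => -α * (z₁ t - z₂ t + inner ℝ (z₃ t) x) + (1 / 2) * ‖x‖ ^ 2 := by
    funext s
    rw [sourceMismatch, eta, mSignal, filteredPosition, norm_sub_sq_real, inner_add_left,
      inner_smul_left, real_inner_self_eq_norm_sq]
    simp only [conj_trivial]
    ring
  rw [heq]
  have h3 : HasDerivWithinAt (fun t => inner ℝ (z₃ t) x)
      (inner ℝ (filteredPosition α z₃ y t) x) (Ici 0) t := by
    simpa using (h.z₃_eq t ht).inner ℝ (hasDerivWithinAt_const t (Ici 0) x)
  refine (((((h.z₁_eq t ht).sub (h.z₂_eq t ht)).add h3).const_mul (-α)).add_const _).congr_deriv ?_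
  exact congrArg (fun r => -α * r) (congrFun heq t)

lemma estimatorRate_eq (t : ℝ) :
    estimatorRate α γ x z₁ z₂ z₃ xhat y t
      = -(γ * (sourceMismatch α x z₁ z₂ z₃ y t
          + inner ℝ (filteredPosition α z₃ y t) (xhat t - x))) • filteredPosition α z₃ y t := by
  rw [estimatorRate, sourceMismatch, inner_sub_right]
  congr 3
  ring

/-- With `u = Vᵀ (x̂ - x)`, the first term contributes `-2γ (ε + u) u`. The weight `γ / (2 α)` makes
the second contribute `-γ ε²`, which completes the squares. -/
lemma hasDerivWithinAt_estimationEnergy (hα : 0 < α)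
    (h : IsTrajectory α γ d A x z₁ z₂ z₃ xhat y) {t : ℝ} (ht : 0 ≤ t) :
    HasDerivWithinAt (estimationEnergy α γ x z₁ z₂ z₃ xhat y)
      (-γ * (inner ℝ (filteredPosition α z₃ y t) (xhat t - x) ^ 2
        + (sourceMismatch α x z₁ z₂ z₃ y t
          + inner ℝ (filteredPosition α z₃ y t) (xhat t - x)) ^ 2)) (Ici 0) t := by
  refine ((((h.xhat_eq t ht).sub_const x).norm_sq).add
    (((h.hasDerivWithinAt_sourceMismatch ht).pow 2).const_mul (γ / (2 * α)))).congr_deriv ?_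
  rw [estimatorRate_eq, inner_smul_right, real_inner_comm]
  push_cast
  field_simp
  ring

lemma estimationEnergy_nonneg (hα : 0 < α) (hγ : 0 < γ) (t : ℝ) :
    0 ≤ estimationEnergy α γ x z₁ z₂ z₃ xhat y t := by
  unfold estimationEnergy
  positivity

lemma norm_estimate_sub_sq_le (hα : 0 < α) (hγ : 0 < γ)
    (h : IsTrajectory α γ d A x z₁ z₂ z₃ xhat y) {t : ℝ} (ht : 0 ≤ t) :
    ‖xhat t - x‖ ^ 2 ≤ estimationEnergy α γ x z₁ z₂ z₃ xhat y 0 := by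
  have hanti := antitoneOn_Ici_of_hasDerivWithinAt
    (fun s hs => h.hasDerivWithinAt_estimationEnergy hα hs)
    (fun s _ => mul_nonpos_of_nonpos_of_nonneg (by linarith) (by positivity))
  refine le_trans ?_ (hanti self_mem_Ici ht ht)
  unfold estimationEnergy
  exact le_add_of_nonneg_right (by positivity)

/-- The control law feeds the estimator's velocity forward, so it cancels in the difference. -/
lemma hasDerivWithinAt_controlError (h : IsTrajectory α γ d A x z₁ z₂ z₃ xhat y) {t : ℝ}
    (ht : 0 ≤ t) :
    HasDerivWithinAt (fun t => y t - xhat t)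
      (-(‖y t - xhat t‖ ^ 2 - d ^ 2) • (y t - xhat t)
        + WithLp.toLp 2 (A t *ᵥ (y t - xhat t).ofLp)) (Ici 0) t := by
  refine ((h.y_eq t ht).sub (h.xhat_eq t ht)).congr_deriv ?_
  rw [sub_right_comm, sub_self, zero_sub, Matrix.sub_mulVec, Matrix.smul_mulVec, Matrix.one_mulVec,
    WithLp.toLp_sub, WithLp.toLp_smul, neg_sub, neg_smul]
  exact sub_eq_neg_add _ _

lemma continuousOn_filteredPosition (h : IsTrajectory α γ d A x z₁ z₂ z₃ xhat y) :
    ContinuousOn (filteredPosition α z₃ y) (Ici 0) :=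
  ((continuousOn_Ici_of_hasDerivWithinAt h.z₃_eq).const_smul (-α)).add
    (continuousOn_Ici_of_hasDerivWithinAt h.y_eq)

lemma exists_norm_filteredPosition_le (hα : 0 < α) (hγ : 0 < γ) (hd : 0 < d)
    (hA : ∀ t, (A t)ᵀ = -A t) (h : IsTrajectory α γ d A x z₁ z₂ z₃ xhat y)
    (hD : 0 < ‖y 0 - xhat 0‖) :
    ∃ M, 0 < M ∧ ∀ t, 0 ≤ t → ‖filteredPosition α z₃ y t‖ ≤ M := by
  set R := √(d ^ 2 + ‖y 0 - xhat 0‖ ^ 2) + √(estimationEnergy α γ x z₁ z₂ z₃ xhat y 0) + ‖x‖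
    with hR
  have hy : ∀ t, 0 ≤ t → ‖y t‖ ≤ R := fun t ht => by
    have h1 : ‖y t - xhat t‖ ≤ √(d ^ 2 + ‖y 0 - xhat 0‖ ^ 2) := Real.le_sqrt_of_sq_le
      (sq_norm_le_of_control (e := fun t => y t - xhat t) hd hA hD (fun s hs => h.hasDerivWithinAt_controlError hs) ht)
    have h2 : ‖xhat t - x‖ ≤ √(estimationEnergy α γ x z₁ z₂ z₃ xhat y 0) :=
      Real.le_sqrt_of_sq_le (h.norm_estimate_sub_sq_le hα hγ ht)
    calc ‖y t‖ = ‖(y t - xhat t) + (xhat t - x) + x‖ := by congr 1; abel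
      _ ≤ _ := norm_add₃_le
      _ ≤ R := by rw [hR]; gcongr
  have hR0 : 0 ≤ R := (norm_nonneg _).trans (hy 0 le_rfl)
  -- The summand `1` only makes the bound strictly positive.
  refine ⟨α * (‖z₃ 0‖ + R / α) + R + 1, by positivity, fun t ht => ?_⟩
  have hz := norm_le_of_stable_filter hα h.z₃_eq hy ht
  have h1 : ‖filteredPosition α z₃ y t‖ ≤ ‖-α • z₃ t‖ + ‖y t‖ := norm_add_le _ _
  rw [norm_smul, norm_neg, Real.norm_of_nonneg hα.le] at h1
  have h2 := mul_le_mul_of_nonneg_left hz hα.le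
  linarith [hy t ht]

lemma exists_norm_estimate_increment_le (hα : 0 < α) (hγ : 0 < γ)
    (h : IsTrajectory α γ d A x z₁ z₂ z₃ xhat y) {M : ℝ}
    (hM : ∀ t, 0 ≤ t → ‖filteredPosition α z₃ y t‖ ≤ M) {σ κ : ℝ} (hσ : 0 < σ) (hκ : 0 < κ) :
    ∃ t₀, 0 ≤ t₀ ∧ ∀ s, t₀ ≤ s → ‖xhat (s + σ) - xhat s‖ ≤ κ := by
  refine exists_norm_increment_le (C := γ * M ^ 2) (by positivity) h.xhat_eq
    (fun t ht => h.hasDerivWithinAt_estimationEnergy hα ht)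
    (estimationEnergy_nonneg hα hγ)
    (fun t _ => mul_nonpos_of_nonpos_of_nonneg (by linarith) (by positivity))
    (fun t ht => ?_) hσ hκ
  rw [estimatorRate_eq, norm_smul, mul_pow, Real.norm_eq_abs, sq_abs]
  set u := inner ℝ (filteredPosition α z₃ y t) (xhat t - x)
  set φ := sourceMismatch α x z₁ z₂ z₃ y t + u
  have h1 : ‖filteredPosition α z₃ y t‖ ^ 2 ≤ M ^ 2 :=
    pow_le_pow_left₀ (norm_nonneg _) (hM t ht) 2
  calc (-(γ * φ)) ^ 2 * ‖filteredPosition α z₃ y t‖ ^ 2 ≤ (-(γ * φ)) ^ 2 * M ^ 2 :=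
        mul_le_mul_of_nonneg_left h1 (sq_nonneg _)
    _ ≤ (γ * φ) ^ 2 * M ^ 2 + (γ * u) ^ 2 * M ^ 2 := by
        rw [neg_sq]
        exact le_add_of_nonneg_right (by positivity)
    _ = γ * M ^ 2 * -(-γ * (u ^ 2 + φ ^ 2)) := by ring

lemma exists_norm_position_increment_sub_le (hα : 0 < α) (hγ : 0 < γ) (hd : 0 < d)
    (hA : AdmissibleMatrix A) (h : IsTrajectory α γ d A x z₁ z₂ z₃ xhat y) {M : ℝ}
    (hM : ∀ t, 0 ≤ t → ‖filteredPosition α z₃ y t‖ ≤ M) {q : ℝ → EuclideanSpace ℝ (Fin n)}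
    (hq : IsLinearSolution A q) (hq1 : ∀ t, 0 ≤ t → ‖q t‖ = 1)
    (hlim : Tendsto (fun t => y t - xhat t - d • q t) atTop (𝓝 0)) {κ : ℝ} (hκ : 0 < κ) :
    ∃ σ, 0 < σ ∧ ∃ t₀, 0 ≤ t₀ ∧ ∀ s, t₀ ≤ s →
      ‖y (s + σ) - y s - σ • d • WithLp.toLp 2 (A s *ᵥ q s)‖ ≤ σ * κ := by
  -- The step `σ` is fixed by `q` first; the starting time may then depend on it. Error budget: `σ κ
  -- / 2` from expanding `d q`, `σ κ / 4` from `x̂`, and `σ κ / 8` from the residual at each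
  -- endpoint.
  obtain ⟨σ, hσ, hqσ⟩ := hq.exists_norm_increment_sub_le hA hq1 (κ := κ / (2 * d)) (by positivity)
  obtain ⟨t₁, ht₁, hx⟩ := h.exists_norm_estimate_increment_le hα hγ hM hσ
    (κ := σ * κ / 4) (by positivity)
  obtain ⟨t₂, ht₂⟩ := Metric.tendsto_atTop.1 hlim (σ * κ / 8) (by positivity)
  refine ⟨σ, hσ, max t₁ t₂, ht₁.trans (le_max_left _ _), fun s hs => ?_⟩
  have hs1 : t₁ ≤ s := (le_max_left _ _).trans hs
  have hs2 : t₂ ≤ s := (le_max_right _ _).trans hs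
  set f := fun t => y t - xhat t - d • q t with hf
  have e1 : ‖f s‖ ≤ σ * κ / 8 := by simpa using (ht₂ s hs2).le
  have e2 : ‖f (s + σ)‖ ≤ σ * κ / 8 := by simpa using (ht₂ (s + σ) (by linarith)).le
  have e3 := hqσ s (ht₁.trans hs1)
  set w := q (s + σ) - q s - σ • WithLp.toLp 2 (A s *ᵥ q s) with hw
  have e4 : ‖d • w‖ ≤ σ * κ / 2 := by
    rw [norm_smul, Real.norm_of_nonneg hd.le]
    calc d * ‖w‖ ≤ d * (σ * (κ / (2 * d))) := mul_le_mul_of_nonneg_left e3 hd.le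
      _ = σ * κ / 2 := by field_simp
  have hsum : y (s + σ) - y s - σ • d • WithLp.toLp 2 (A s *ᵥ q s)
      = (xhat (s + σ) - xhat s) + (f (s + σ) - f s) + d • w := by
    simp only [hf, hw]
    module
  rw [hsum]
  have h1 := norm_add₃_le (a := xhat (s + σ) - xhat s) (b := f (s + σ) - f s) (c := d • w)
  have h2 := norm_sub_le (f (s + σ)) (f s)
  linarith [hx s hs1]

end IsTrajectory

lemma integral_sq_inner_le {n : ℕ} {V : ℝ → EuclideanSpace ℝ (Fin n)} {M : ℝ}
    (hV : ContinuousOn V (Ici 0)) (hM : ∀ t, 0 ≤ t → ‖V t‖ ≤ M) {t T : ℝ} (ht : 0 ≤ t)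
    (hT : 0 ≤ T) (θ : EuclideanSpace ℝ (Fin n)) :
    ∫ τ in t..t + T, inner ℝ θ (V τ) ^ 2 ≤ T * M ^ 2 * ‖θ‖ ^ 2 := by
  have hab : t ≤ t + T := by linarith
  have hmono := integral_mono_on hab
    (intervalIntegrable_of_continuousOn_Ici (f := fun τ => inner ℝ θ (V τ) ^ 2)
      ((continuousOn_const.inner hV).pow 2) ht hab)
    (intervalIntegrable_const (c := (‖θ‖ * M) ^ 2)) fun τ hτ => by
      rw [← sq_abs]
      exact pow_le_pow_left₀ (abs_nonneg _) ((abs_real_inner_le_norm _ _).trans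
        (mul_le_mul_of_nonneg_left (hM τ (ht.trans hτ.1)) (norm_nonneg _))) 2
  refine hmono.trans (le_of_eq ?_)
  simp
  ring

end Circumnavigation

end

theorem mainTheorem3 (n : ℕ) (hn : n = 2 ∨ n = 3)
    (α γ d : ℝ) (hα : 0 < α) (hγ : 0 < γ) (hd : 0 < d)
    (A : ℝ → Matrix (Fin n) (Fin n) ℝ) (hA : Circumnavigation.AdmissibleMatrix A)
    (x : EuclideanSpace ℝ (Fin n)) (z₁ z₂ : ℝ → ℝ)
    (z₃ xhat y : ℝ → EuclideanSpace ℝ (Fin n))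
    (hsys : Circumnavigation.IsTrajectory α γ d A x z₁ z₂ z₃ xhat y)
    (hD : 0 < ‖y 0 - xhat 0‖) :
    ∃ α₃ α₄ T₃ : ℝ, 0 < α₃ ∧ 0 < α₄ ∧ 0 < T₃ ∧ ∀ t : ℝ, 0 ≤ t →
      α₃ • (1 : Matrix (Fin n) (Fin n) ℝ)
          ≤ Circumnavigation.gramian (Circumnavigation.filteredPosition α z₃ y) t (t + T₃) ∧
        Circumnavigation.gramian (Circumnavigation.filteredPosition α z₃ y) t (t + T₃)
          ≤ α₄ • (1 : Matrix (Fin n) (Fin n) ℝ) := by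
  open Circumnavigation in
  obtain ⟨M, hM0, hM⟩ := hsys.exists_norm_filteredPosition_le hα hγ hd hA.skew hD
  obtain ⟨q, hq, hq1, hlim⟩ := exists_linearSolution_of_control (e := fun t => y t - xhat t) hd hA.skew hD
    fun t ht => hsys.hasDerivWithinAt_controlError ht
  have hq0 : q 0 ≠ 0 := norm_pos_iff.1 (by rw [hq1 0 le_rfl]; exact one_pos)
  obtain ⟨T₁, α₁, _, hT₁, hα₁, _, hspan⟩ := hA.spanning q hq hq0
  have hq'c := hq.continuousOn_deriv hA.continuous
  have hdqc : ContinuousOn (derivWithin q (Ici 0)) (Ici 0) :=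
    hq'c.congr fun t ht => hq.derivWithin_eq ht
  have hVc := hsys.continuousOn_filteredPosition
  have hPE : ∀ t, 0 ≤ t → ∀ θ : EuclideanSpace ℝ (Fin n), d ^ 2 * α₁ * ‖θ‖ ^ 2
      ≤ ∫ τ in t..t + T₁, inner ℝ θ (d • WithLp.toLp 2 (A τ *ᵥ q τ)) ^ 2 := by
    intro t ht θ
    have h1 := (smul_one_le_gramian_iff hdqc ht (by linarith) _).1 (hspan t ht).1 θ
    -- Unit norm turns the bound relative to `‖q t‖²` into one uniform in `t`.
    rw [hq1 t ht, one_pow, mul_one] at h1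
    have h2 : ∫ τ in t..t + T₁, inner ℝ θ (d • WithLp.toLp 2 (A τ *ᵥ q τ)) ^ 2
        = d ^ 2 * ∫ τ in t..t + T₁, inner ℝ θ (derivWithin q (Ici 0) τ) ^ 2 := by
      rw [← intervalIntegral.integral_const_mul]
      refine intervalIntegral.integral_congr fun τ hτ => ?_
      rw [uIcc_of_le (by linarith)] at hτ
      simp only [hq.derivWithin_eq (ht.trans hτ.1), inner_smul_right]
      ring
    rw [h2, mul_assoc]
    exact mul_le_mul_of_nonneg_left h1 (sq_nonneg d)
  obtain ⟨c, T₃, hc, hT₃, hlow⟩ := exists_le_integral_sq_inner_of_increments (α := α)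
    (a := d ^ 2 * α₁) (by positivity) hT₁ hVc (hq'c.const_smul d) hsys.z₃_eq hPE fun κ hκ => by
      obtain ⟨σ, hσ, t₀, ht₀, hs⟩ :=
        hsys.exists_norm_position_increment_sub_le hα hγ hd hA hM hq hq1 hlim hκ
      refine ⟨σ, hσ, t₀, ht₀, fun s hst => ?_⟩
      have heq : filteredPosition α z₃ y (s + σ) - filteredPosition α z₃ y s
          + α • (z₃ (s + σ) - z₃ s) = y (s + σ) - y s := by
        simp only [filteredPosition]
        module
      rw [heq]
      exact hs s hst
  refine ⟨c, T₃ * M ^ 2, T₃, hc, by positivity, hT₃, fun t ht => ⟨?_, ?_⟩⟩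
  · exact (smul_one_le_gramian_iff hVc ht (by linarith) c).2 (hlow t ht)
  · exact (gramian_le_smul_one_iff hVc ht (by linarith) _).2
      (integral_sq_inner_le hVc hM ht hT₃.le)
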